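/- **Theorem.** For natural numbers $q\ge 1$ and $0\le p\le q-1$ let $\beta_{p,q}:[0,1]\to\mathbb R$ be $$\beta_{p,q}(x)=\begin{cases}0 & \text{if } 0\le x\le \frac pq,\\ 2^q\left(x-\frac pq\right) & \text{if } \frac pq\le x\le \frac{p+2^{-q}}{q},\\ \frac1q & \text{if } \frac{p+2^{-q}}{q}\le x\le 1,\end{cases}$$ and let $$\alpha_q(x)=\sum_{p=0}^{q-1}\beta_{p,q}(x),\qquad \mathcal F(x)=\sum_{q=1}^{\infty}\frac1{q^2}\,\alpha_q(x)\qquad(x\in[0,1]).$$ Then $\mathcal F$ is not a polynomial time computable real function on $[0,1]$, i.e. $\mathcal F\notin \mathrm{FPTIME}_{C[0,1]}$. Here, for a real number $x$, $CF_x$ is the set of all functions $\phi$ from $\mathbb N$ to the dyadic rationals with $|\phi(n)-x|\le 2^{-n}$ for all $n$, and $x$ is computable if $CF_x$ contains a computable function. A function-oracle Turing machine is a deterministic multitape Turing machine that, given an oracle $\phi$, may ask for the value $\phi(m)$ by writing $m$ in unary on its query tape; it receives the binary expansion of $\phi(m)$ on its answer tape, and the whole query costs one time unit. Inputs $n$ are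 given in unary, outputs are binary expansions of dyadic rationals. A machine $M$ computes $f:[a,b]\to\mathbb R$ on $[a,b]$ if for all $x\in[a,b]$ and all $\phi\in CF_x$ the function $\psi$ computed by $M$ with oracle $\phi$ is in $CF_{f(x)}$. The class $\mathrm{FPTIME}_{C[a,b]}$ consists of the functions $f:[a,b]\to\mathbb R$ for which some machine $M$ computes $f$ on $[a,b]$ and, for all computable $x\in[a,b]$ and all $\phi\in CF_x$, computes $\psi(n)$ in time polynomial in $n$; the polynomial is allowed to depend on $x$ and $\phi$, so that in particular every $f$ computed by a machine with a single polynomial time bound for all $x\in[a,b]$ and all $\phi\in CF_x$ belongs to the class. -/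

import Mathlib

/-! ### Dyadic rationals as words -/

/-- The symbols used to write unary numbers and dyadic rationals: the two binary digits, the minus
sign and the binary point. -/
inductive IOSym where
  | zero
  | one
  | minus
  | point

/-- A binary digit as a symbol. -/
def bitSym (b : Bool) : IOSym := if b then IOSym.one else IOSym.zero

/-- The binary expansion of a dyadic rational `d = ± a / 2 ^ k` in lowest terms: a minus sign if
`d < 0`, the integer part in binary (most significant digit first, no leading zeros, so empty if the
integer part is `0`), the binary point, and the `k` fractional digits (most significant first). -/
def encodeDyadic (d : Dyadic) : List IOSym :=
  (if d.toRat.num < 0 then [IOSym.minus] else []) ++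
    ((d.toRat.num.natAbs / d.toRat.den).bits.reverse.map bitSym) ++
    [IOSym.point] ++
    (List.range (Nat.log 2 d.toRat.den)).map
      (fun i => bitSym (d.toRat.num.natAbs.testBit (Nat.log 2 d.toRat.den - 1 - i)))

/-! ### Cauchy functions -/

/-- `CF x`: the set of all functions `φ` from `ℕ` to the dyadic rationals which binary converge to
`x`, that is, `|φ n - x| ≤ 2 ^ (-n)` for all `n`. -/
def CF (x : ℝ) : Set (ℕ → Dyadic) :=
  {φ | ∀ n : ℕ, |((φ n).toRat : ℝ) - x| ≤ 1 / 2 ^ n}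

/-- A function from `ℕ` to the dyadic rationals is computable if its numerator and its denominator
(in lowest terms) are computable. -/
def ComputableDyadicSeq (φ : ℕ → Dyadic) : Prop :=
  Computable (fun n => (φ n).toRat.num) ∧ Computable (fun n => (φ n).toRat.den)

/-- A real number `x` is computable if `CF x` contains a computable function. -/
def ComputableReal (x : ℝ) : Prop :=
  ∃ φ ∈ CF x, ComputableDyadicSeq φ

/-! ### Function-oracle Turing machines -/

/-- The tapes of a machine: an input tape, a query tape, an answer tape, an output tape and
`k` work tapes. -/
inductive TapeName (k : ℕ) where
  | input
  | query
  | answer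
  | output
  | work (i : Fin k)

/-- Tape symbols: the blank `none`, the symbols `IOSym`, and auxiliary symbols from `W`. -/
abbrev TapeSym (W : Type) : Type := Option (IOSym ⊕ W)

/-- A deterministic function-oracle Turing machine with finitely many states, a finite tape alphabet
and finitely many two-way infinite tapes. In one move it reads the scanned symbols of all the tapes,
changes its state, writes one symbol on each tape and moves each head by at most one cell
(`none`: the head stays). -/
structure OracleTM where
  State : Type
  [finState : Finite State]
  [decState : DecidableEq State]
  W : Type
  [finW : Finite W]
  numWork : ℕ
  start : State
  halt : State
  /-- in this state the oracle is called -/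
  query : State
  /-- the state of the machine after a call of the oracle -/
  answer : State
  trans : State → (TapeName numWork → TapeSym W) →
    State × (TapeName numWork → TapeSym W × Option Turing.Dir)

namespace OracleTM

attribute [instance] OracleTM.finState OracleTM.decState OracleTM.finW

/-- Configurations: the state and the tapes with their heads. -/
structure Cfg (M : OracleTM) where
  state : M.State
  tape : TapeName M.numWork → Turing.Tape (TapeSym M.W)

/-- The tape with the word `w` on it, all other cells blank, the head on the first symbol. -/
def wordTape (W : Type) (w : List IOSym) : Turing.Tape (TapeSym W) :=
  Turing.Tape.mk₁ (w.map fun s => some (Sum.inl s))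

/-- The unary number on a tape: the number of consecutive symbols `0` that start in the scanned cell
and extend to the right. -/
noncomputable def unaryValue {W : Type} (T : Turing.Tape (TapeSym W)) : ℕ :=
  sInf {j : ℕ | T.nth j ≠ some (Sum.inl IOSym.zero)}

/-- The word `w` stands on a tape: it starts in the scanned cell, extends to the right and is
followed by a blank. -/
def HasWord {W : Type} (T : Turing.Tape (TapeSym W)) (w : List IOSym) : Prop :=
  ∀ i : ℕ, i ≤ w.length → T.nth i = (w[i]?).map Sum.inl

/-- Write a symbol and then move the head. -/
def act {W : Type} (T : Turing.Tape (TapeSym W)) (a : TapeSym W × Option Turing.Dir) :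
    Turing.Tape (TapeSym W) :=
  match a.2 with
  | none => T.write a.1
  | some dir => (T.write a.1).move dir

variable (M : OracleTM)

/-- The initial configuration on input `n`: the unary number `0 ^ n` is on the input tape, all other
tapes are blank. -/
def init (n : ℕ) : M.Cfg where
  state := M.start
  tape := fun t => match t with
    | .input => wordTape M.W (List.replicate n IOSym.zero)
    | _ => default

/-- One time unit of the machine with oracle `φ`. A halted machine does not change any more. In the
query state with the unary number `m` on the query tape, the query tape is erased, the binary
expansion of `φ m` replaces the contents of the answer tape, and the machine enters the
answer state. In all other states the transition function is applied. -/
noncomputable def step (φ : ℕ → Dyadic) (c : M.Cfg) : M.Cfg :=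
  if c.state = M.halt then c
  else if c.state = M.query then
    { state := M.answer
      tape := fun t => match t with
        | .query => default
        | .answer => wordTape M.W (encodeDyadic (φ (unaryValue (c.tape .query))))
        | t => c.tape t }
  else
    let r := M.trans c.state (fun t => (c.tape t).head)
    { state := r.1
      tape := fun t => act (c.tape t) (r.2 t) }

/-- The configuration after `t` time units on input `n` with oracle `φ`. -/
noncomputable def run (φ : ℕ → Dyadic) (n t : ℕ) : M.Cfg :=
  (M.step φ)^[t] (M.init n)

/-- On input `n` with oracle `φ` the machine halts within `t` time units. -/
def HaltsWithin (φ : ℕ → Dyadic) (n t : ℕ) : Prop :=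
  (M.run φ n t).state = M.halt

/-- On input `n` with oracle `φ` the machine halts with the binary expansion of `d` on its
output tape. -/
def Outputs (φ : ℕ → Dyadic) (n : ℕ) (d : Dyadic) : Prop :=
  ∃ t : ℕ, M.HaltsWithin φ n t ∧ HasWord ((M.run φ n t).tape .output) (encodeDyadic d)

/-- With oracle `φ` the machine computes the function `ψ`. -/
def ComputesSeq (φ ψ : ℕ → Dyadic) : Prop :=
  ∀ n : ℕ, M.Outputs φ n (ψ n)

/-- The machine computes the real function `f` on `[a, b]`: for all `x` in `[a, b]` and all `φ` in
`CF x`, the function computed by the machine with oracle `φ` is in `CF (f x)`. -/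
def ComputesOn {a b : ℝ} (f : Set.Icc a b → ℝ) : Prop :=
  ∀ x : Set.Icc a b, ∀ φ ∈ CF x, ∃ ψ ∈ CF (f x), M.ComputesSeq φ ψ

/-- With oracle `φ` the running time of the machine is bounded by a polynomial in the input. -/
def PolyTime (φ : ℕ → Dyadic) : Prop :=
  ∃ p : Polynomial ℕ, ∀ n : ℕ, M.HaltsWithin φ n (p.eval n)

end OracleTM

/-- The class of polynomial time computable real functions on `[a, b]`: the real functions `f` for
which there is a machine that computes `f` on `[a, b]` and computes `ψ` in `CF (f x)` in polynomial
time for all computable `x` in `[a, b]` and all oracles `φ` in `CF x`. The polynomial may depend on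
`x` and `φ`; so a machine with one polynomial bound for all `x` and `φ` is admitted in particular. -/
def FPTIME (a b : ℝ) : Set (Set.Icc a b → ℝ) :=
  {f | ∃ M : OracleTM, M.ComputesOn f ∧
    ∀ x : Set.Icc a b, ComputableReal x → ∀ φ ∈ CF x, M.PolyTime φ}

/-! ### The function -/

/-- The ramp of slope `2 ^ q` from the value `0` at `p / q` to the value `1 / q` at
`(p + 1 / 2 ^ q) / q`. -/
noncomputable def rampBeta (p q : ℕ) (x : ℝ) : ℝ :=
  if x ≤ (p : ℝ) / q then 0
  else if x ≤ ((p : ℝ) + 1 / 2 ^ q) / q then 2 ^ q * (x - (p : ℝ) / q)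
  else 1 / q

/-- The sum of the ramps `rampBeta p q` over `p = 0, …, q - 1`. -/
noncomputable def alphaSum (q : ℕ) (x : ℝ) : ℝ :=
  ∑ p ∈ Finset.range q, rampBeta p q x

/-- The function `F x = ∑ (1 / q ^ 2) * α_q x` on `[0, 1]`, the sum over `q = 1, 2, …`, written with
`q = i + 1`. The series converges by `summable_seriesF`. -/
noncomputable def seriesF (x : Set.Icc (0 : ℝ) 1) : ℝ :=
  ∑' i : ℕ, 1 / ((i + 1 : ℕ) : ℝ) ^ 2 * alphaSum (i + 1) x

theorem rampBeta_mem (p q : ℕ) (hq : 1 ≤ q) (x : ℝ) :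
    0 ≤ rampBeta p q x ∧ rampBeta p q x ≤ 1 / q := by
  have hq' : (0 : ℝ) < q := by exact_mod_cast hq
  have h2 : (0 : ℝ) < 2 ^ q := by positivity
  unfold rampBeta
  split_ifs with h1 h3
  · exact ⟨le_rfl, by positivity⟩
  · have hx : 0 ≤ x - (p : ℝ) / q := by linarith [not_le.mp h1]
    refine ⟨by positivity, ?_⟩
    have h4 : x - (p : ℝ) / q ≤ 1 / 2 ^ q / q := by rw [add_div] at h3; linarith
    calc 2 ^ q * (x - (p : ℝ) / q) ≤ 2 ^ q * (1 / 2 ^ q / q) := by gcongr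
      _ = 1 / q := by field_simp
  · exact ⟨by positivity, le_rfl⟩

theorem alphaSum_mem (q : ℕ) (hq : 1 ≤ q) (x : ℝ) : 0 ≤ alphaSum q x ∧ alphaSum q x ≤ 1 := by
  have hq' : (0 : ℝ) < q := by exact_mod_cast hq
  refine ⟨Finset.sum_nonneg fun p _ => (rampBeta_mem p q hq x).1, ?_⟩
  calc alphaSum q x ≤ ∑ _p ∈ Finset.range q, (1 : ℝ) / q :=
        Finset.sum_le_sum fun p _ => (rampBeta_mem p q hq x).2
    _ = 1 := by simp; field_simp

theorem summable_seriesF (x : ℝ) :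
    Summable fun i : ℕ => 1 / ((i + 1 : ℕ) : ℝ) ^ 2 * alphaSum (i + 1) x := by
  have h : Summable fun i : ℕ => 1 / ((i + 1 : ℕ) : ℝ) ^ 2 :=
    (summable_nat_add_iff 1).mpr (Real.summable_one_div_nat_pow.mpr one_lt_two)
  refine Summable.of_nonneg_of_le (fun i => ?_) (fun i => ?_) h
  · exact mul_nonneg (by positivity) (alphaSum_mem (i + 1) (by omega) x).1
  · exact mul_le_of_le_one_right (by positivity) (alphaSum_mem (i + 1) (by omega) x).2

/-! ### The binary expansion determines the dyadic rational -/

theorem bitSym_injective : Function.Injective bitSym := by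
  intro a b h
  cases a <;> cases b <;> simp_all [bitSym]

theorem bitSym_ne_minus (b : Bool) : bitSym b ≠ IOSym.minus := by
  cases b <;> simp [bitSym]

theorem bitSym_ne_point (b : Bool) : bitSym b ≠ IOSym.point := by
  cases b <;> simp [bitSym]

theorem Nat.bits_injective : Function.Injective Nat.bits := by
  intro m n h
  apply Nat.digits_inj_iff (b := 2) |>.mp
  rw [Nat.digits_two_eq_bits, Nat.digits_two_eq_bits, h]

theorem Dyadic.exists_den_toRat_eq (d : Dyadic) : ∃ k : ℕ, d.toRat.den = 2 ^ k := by
  rcases d with _ | ⟨n, k | k, hn⟩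
  · exact ⟨0, rfl⟩
  · exact ⟨k, rfl⟩
  · exact ⟨0, rfl⟩

theorem minus_mem_encodeDyadic (d : Dyadic) :
    IOSym.minus ∈ encodeDyadic d ↔ d.toRat.num < 0 := by
  by_cases h : d.toRat.num < 0 <;> simp [encodeDyadic, h, bitSym_ne_minus]

theorem Nat.eq_of_div_two_pow_eq_of_testBit_eq {a b k : ℕ} (h : a / 2 ^ k = b / 2 ^ k)
    (h' : ∀ i < k, a.testBit i = b.testBit i) : a = b := by
  apply Nat.eq_of_testBit_eq
  intro i
  rcases lt_or_ge i k with hi | hi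
  · exact h' i hi
  · have := congrArg (fun m => Nat.testBit m (i - k)) h
    simpa [Nat.testBit_div_two_pow, Nat.sub_add_cancel hi, Nat.add_sub_cancel' hi] using this

theorem encodeDyadic_injective : Function.Injective encodeDyadic := by
  intro d e h
  have hs : d.toRat.num < 0 ↔ e.toRat.num < 0 := by
    rw [← minus_mem_encodeDyadic, ← minus_mem_encodeDyadic, h]
  obtain ⟨k, hk⟩ := d.exists_den_toRat_eq
  obtain ⟨l, hl⟩ := e.exists_den_toRat_eq
  simp only [encodeDyadic, hs, hk, hl, Nat.log_pow one_lt_two, List.append_assoc,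
    List.append_cancel_left_eq, List.singleton_append] at h
  rw [List.append_cons_inj_of_notMem (by simp [bitSym_ne_point])
    (by simp [bitSym_ne_point])] at h
  obtain ⟨hI, -, hF⟩ := h
  have hkl : k = l := by simpa using congrArg List.length hF
  subst hkl
  have hI' := Nat.bits_injective
    (List.reverse_injective ((List.map_injective_iff.mpr bitSym_injective) hI))
  have habs : d.toRat.num.natAbs = e.toRat.num.natAbs := by
    refine Nat.eq_of_div_two_pow_eq_of_testBit_eq hI' fun i hi => ?_
    have := List.map_inj_left.mp hF (k - 1 - i) (by simp; omega)
    have := bitSym_injective this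
    rwa [show k - 1 - (k - 1 - i) = i by omega] at this
  rw [← Dyadic.toRat_inj]
  refine Rat.ext ?_ (by rw [hk, hl])
  omega

namespace OracleTM

theorem HasWord.length_le {W : Type} {T : Turing.Tape (TapeSym W)} {v w : List IOSym}
    (hv : HasWord T v) (hw : HasWord T w) : v.length ≤ w.length := by
  by_contra! hlt
  have h1 := hv w.length hlt.le
  have h2 := hw w.length le_rfl
  rw [h1] at h2
  simp [hlt] at h2

theorem HasWord.eq {W : Type} {T : Turing.Tape (TapeSym W)} {v w : List IOSym}
    (hv : HasWord T v) (hw : HasWord T w) : v = w := by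
  have hl : v.length = w.length := (hv.length_le hw).antisymm (hw.length_le hv)
  apply List.ext_getElem?
  intro i
  rcases le_or_gt i v.length with hi | hi
  · have h := (hv i hi).symm.trans (hw i (hl ▸ hi))
    exact Option.map_injective Sum.inl_injective h
  · rw [List.getElem?_eq_none hi.le, List.getElem?_eq_none (hl ▸ hi.le)]

/-! ### In `t` time units only numbers up to `t` can be queried -/

/-- At most `t` cells of the tape contain the symbol `0`. -/
def ZerosLE {W : Type} (T : Turing.Tape (TapeSym W)) (t : ℕ) : Prop :=
  ∃ S : Finset ℤ, S.card ≤ t ∧ ∀ i, T.nth i = some (Sum.inl IOSym.zero) → i ∈ S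

theorem default_nth {W : Type} (i : ℤ) : (default : Turing.Tape (TapeSym W)).nth i = none := by
  rcases i with (_ | n) | n
  · rfl
  · exact (Turing.ListBlank.nth_mk [] n).trans (by simp; rfl)
  · exact (Turing.ListBlank.nth_mk [] n).trans (by simp; rfl)

theorem zerosLE_default {W : Type} (t : ℕ) :
    ZerosLE (default : Turing.Tape (TapeSym W)) t :=
  ⟨∅, by simp, fun i hi => by simp [default_nth] at hi⟩

theorem ZerosLE.mono {W : Type} {T : Turing.Tape (TapeSym W)} {s t : ℕ} (h : ZerosLE T s)
    (hst : s ≤ t) : ZerosLE T t :=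
  let ⟨S, hS, hT⟩ := h
  ⟨S, hS.trans hst, hT⟩

theorem ZerosLE.write {W : Type} {T : Turing.Tape (TapeSym W)} {t : ℕ} (h : ZerosLE T t)
    (a : TapeSym W) : ZerosLE (T.write a) (t + 1) := by
  obtain ⟨S, hS, hT⟩ := h
  refine ⟨insert 0 S, (Finset.card_insert_le _ _).trans (by omega), fun i hi => ?_⟩
  rw [Turing.Tape.write_nth] at hi
  split_ifs at hi with h0
  · simp [h0]
  · exact Finset.mem_insert_of_mem (hT i hi)

theorem ZerosLE.move {W : Type} {T : Turing.Tape (TapeSym W)} {t : ℕ} (h : ZerosLE T t)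
    (dir : Turing.Dir) : ZerosLE (T.move dir) t := by
  obtain ⟨S, hS, hT⟩ := h
  cases dir with
  | left =>
    refine ⟨S.image (· + 1), Finset.card_image_le.trans hS, fun i hi => ?_⟩
    rw [Turing.Tape.move_left_nth] at hi
    exact Finset.mem_image.mpr ⟨i - 1, hT _ hi, by ring⟩
  | right =>
    refine ⟨S.image (· - 1), Finset.card_image_le.trans hS, fun i hi => ?_⟩
    rw [Turing.Tape.move_right_nth] at hi
    exact Finset.mem_image.mpr ⟨i + 1, hT _ hi, by ring⟩

theorem ZerosLE.act {W : Type} {T : Turing.Tape (TapeSym W)} {t : ℕ} (h : ZerosLE T t)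
    (a : TapeSym W × Option Turing.Dir) : ZerosLE (act T a) (t + 1) := by
  obtain ⟨a, _ | dir⟩ := a
  · exact h.write a
  · exact (h.write a).move dir

theorem ZerosLE.unaryValue_le {W : Type} {T : Turing.Tape (TapeSym W)} {t : ℕ}
    (h : ZerosLE T t) : unaryValue T ≤ t := by
  obtain ⟨S, hS, hT⟩ := h
  refine le_trans ?_ hS
  have hsub : (Finset.range (unaryValue T)).image (fun j : ℕ => (j : ℤ)) ⊆ S := by
    intro i hi
    obtain ⟨j, hj, rfl⟩ := Finset.mem_image.mp hi
    refine hT _ ?_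
    by_contra hne
    exact Nat.notMem_of_lt_sInf (Finset.mem_range.mp hj) hne
  simpa [Finset.card_image_of_injective _ Nat.cast_injective] using Finset.card_le_card hsub

variable (M : OracleTM)

theorem run_succ (φ : ℕ → Dyadic) (n t : ℕ) : M.run φ n (t + 1) = M.step φ (M.run φ n t) :=
  Function.iterate_succ_apply' _ _ _

theorem zerosLE_step (φ : ℕ → Dyadic) (c : M.Cfg) (t : ℕ) (h : ZerosLE (c.tape .query) t) :
    ZerosLE ((M.step φ c).tape .query) (t + 1) := by
  unfold step
  split_ifs
  · exact h.mono t.le_succ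
  · exact zerosLE_default _
  · exact h.act _

theorem zerosLE_run (φ : ℕ → Dyadic) (n t : ℕ) : ZerosLE ((M.run φ n t).tape .query) t := by
  induction t with
  | zero => exact zerosLE_default _
  | succ t ih => rw [run_succ]; exact M.zerosLE_step φ _ t ih

theorem step_congr {φ ψ : ℕ → Dyadic} {c : M.Cfg}
    (h : φ (unaryValue (c.tape .query)) = ψ (unaryValue (c.tape .query))) :
    M.step φ c = M.step ψ c := by
  simp only [step, h]

/-- The configurations up to time `t` depend only on the values of the oracle up to `t`. -/
theorem run_congr {φ ψ : ℕ → Dyadic} (n t : ℕ) (h : ∀ m ≤ t, φ m = ψ m) :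
    M.run φ n t = M.run ψ n t := by
  induction t with
  | zero => rfl
  | succ t ih =>
    rw [run_succ, run_succ, ← ih fun m hm => h m (hm.trans t.le_succ)]
    exact M.step_congr (h _ ((M.zerosLE_run φ n t).unaryValue_le.trans t.le_succ))

variable {M}

theorem HaltsWithin.run_eq {φ : ℕ → Dyadic} {n s t : ℕ} (h : M.HaltsWithin φ n s)
    (hst : s ≤ t) : M.run φ n t = M.run φ n s := by
  induction t, hst using Nat.le_induction with
  | base => rfl
  | succ t _ ih => rw [run_succ, ih]; exact if_pos h

theorem Outputs.hasWord_of_haltsWithin {φ : ℕ → Dyadic} {n t : ℕ} {d : Dyadic}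
    (h : M.Outputs φ n d) (ht : M.HaltsWithin φ n t) :
    HasWord ((M.run φ n t).tape .output) (encodeDyadic d) := by
  obtain ⟨s, hs, hw⟩ := h
  rcases le_total s t with hst | hst
  · rwa [hs.run_eq hst]
  · rwa [← ht.run_eq hst]

/-- If two oracles agree up to the running time, then the outputs agree. -/
theorem Outputs.eq_of_agree {φ ψ : ℕ → Dyadic} {n t : ℕ} {d e : Dyadic}
    (hd : M.Outputs φ n d) (he : M.Outputs ψ n e) (ht : M.HaltsWithin φ n t)
    (h : ∀ m ≤ t, φ m = ψ m) : d = e := by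
  have hrun := M.run_congr n t h
  have ht' : M.HaltsWithin ψ n t := by rwa [HaltsWithin, ← hrun]
  have hw := he.hasWord_of_haltsWithin ht'
  rw [← hrun] at hw
  exact encodeDyadic_injective ((hd.hasWord_of_haltsWithin ht).eq hw)

end OracleTM

/-! ### Behaviour of the function near `0` -/

theorem seriesF_zero (h : (0 : ℝ) ∈ Set.Icc (0 : ℝ) 1) : seriesF ⟨0, h⟩ = 0 := by
  have hr (p q : ℕ) : rampBeta p q 0 = 0 := if_pos (by positivity)
  simp [seriesF, alphaSum, hr]

theorem le_seriesF (T : ℕ) (h : (1 / 2 ^ T : ℝ) ∈ Set.Icc (0 : ℝ) 1) :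
    1 / ((T + 1 : ℕ) : ℝ) ^ 3 ≤ seriesF ⟨1 / 2 ^ T, h⟩ := by
  have hterm : 1 / ((T + 1 : ℕ) : ℝ) ^ 2 * alphaSum (T + 1) (1 / 2 ^ T) ≤
      seriesF ⟨1 / 2 ^ T, h⟩ :=
    (summable_seriesF (1 / 2 ^ T)).le_tsum T fun i _ =>
      mul_nonneg (by positivity) (alphaSum_mem (i + 1) (by omega) _).1
  have hramp : rampBeta 0 (T + 1) (1 / 2 ^ T) = 1 / ((T + 1 : ℕ) : ℝ) := by
    have h2 : (0 : ℝ) < 1 / 2 ^ T := by positivity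
    have hlt : (1 / 2 ^ (T + 1) : ℝ) / ((T + 1 : ℕ) : ℝ) < 1 / 2 ^ T := by
      rw [div_div]
      apply one_div_lt_one_div_of_lt (by positivity)
      have h1 : (1 : ℝ) ≤ ((T + 1 : ℕ) : ℝ) := by exact_mod_cast Nat.le_add_left 1 T
      have h3 : (0 : ℝ) < 2 ^ T := by positivity
      rw [pow_succ]
      nlinarith
    unfold rampBeta
    rw [if_neg (by simp), if_neg (by simpa using hlt)]
  have halpha : 1 / ((T + 1 : ℕ) : ℝ) ≤ alphaSum (T + 1) (1 / 2 ^ T) := by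
    rw [← hramp]
    exact Finset.single_le_sum (f := fun p => rampBeta p (T + 1) (1 / 2 ^ T))
      (fun p _ => (rampBeta_mem p (T + 1) (by omega) _).1) (by simp)
  refine le_trans ?_ hterm
  calc 1 / ((T + 1 : ℕ) : ℝ) ^ 3
      = 1 / ((T + 1 : ℕ) : ℝ) ^ 2 * (1 / ((T + 1 : ℕ) : ℝ)) := by
        rw [one_div_mul_one_div, ← pow_succ]
    _ ≤ _ := by gcongr

/-! ### Polynomials grow more slowly than `2 ^ n` -/

theorem tendsto_polynomial_eval_div_two_pow (P : Polynomial ℕ) :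
    Filter.Tendsto (fun n : ℕ => ((P.eval n : ℕ) : ℝ) / 2 ^ n) Filter.atTop (nhds 0) := by
  induction P using Polynomial.induction_on' with
  | add P Q hP hQ => simpa [add_div] using hP.add hQ
  | monomial k a =>
    simpa [mul_div_assoc] using
      (tendsto_pow_const_div_const_pow_of_one_lt k (one_lt_two (α := ℝ))).const_mul (a : ℝ)

theorem exists_polynomial_eval_lt_two_pow (P : Polynomial ℕ) :
    ∃ n : ℕ, ((P.eval n : ℕ) : ℝ) < 2 ^ n := by
  obtain ⟨n, hn⟩ :=
    ((tendsto_polynomial_eval_div_two_pow P).eventually (gt_mem_nhds one_pos)).exists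
  exact ⟨n, (div_lt_one (by positivity)).mp hn⟩

/-! ### The theorem -/

theorem const_zero_mem_CF : (fun _ => 0 : ℕ → Dyadic) ∈ CF 0 := fun n => by simp

theorem computableReal_zero : ComputableReal 0 :=
  ⟨_, const_zero_mem_CF, Computable.const _, Computable.const _⟩

/-- The Cauchy function of `2 ^ (-T)` which is `0` as long as possible. -/
theorem ite_mem_CF (T : ℕ) :
    (fun m => if m ≤ T then 0 else Dyadic.ofIntWithPrec 1 T) ∈ CF (1 / 2 ^ T) := by
  intro m
  dsimp only
  split_ifs with h
  · rw [Dyadic.toRat_zero, Rat.cast_zero, zero_sub, abs_neg, abs_of_nonneg (by positivity)]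
    exact one_div_le_one_div_of_le (by positivity) (pow_le_pow_right₀ one_le_two h)
  · simp [Dyadic.toRat_ofIntWithPrec_eq_mul_two_pow]

theorem mainTheorem1 : seriesF ∉ FPTIME 0 1 := by
  rintro ⟨M, hM, hpoly⟩
  have h0 : (0 : ℝ) ∈ Set.Icc (0 : ℝ) 1 := by simp
  obtain ⟨p, hp⟩ := hpoly ⟨0, h0⟩ computableReal_zero _ const_zero_mem_CF
  obtain ⟨n, hn⟩ := exists_polynomial_eval_lt_two_pow (2 * (p + 1) ^ 3)
  set T := p.eval n with hT
  have hx : (1 / 2 ^ T : ℝ) ∈ Set.Icc (0 : ℝ) 1 :=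
    ⟨by positivity, div_le_one_of_le₀ (one_le_pow₀ one_le_two) (by positivity)⟩
  obtain ⟨ψ, hψ, hψM⟩ := hM ⟨0, h0⟩ _ const_zero_mem_CF
  obtain ⟨ψ', hψ', hψM'⟩ := hM ⟨1 / 2 ^ T, hx⟩ _ (ite_mem_CF T)
  have heq : ψ n = ψ' n :=
    (hψM n).eq_of_agree (hψM' n) (hp n) fun m hm => (if_pos hm).symm
  have h1 := hψ n
  have h2 := hψ' n
  rw [seriesF_zero, sub_zero] at h1
  rw [← heq] at h2
  have h3 := le_seriesF T hx
  have h4 : 1 / ((T + 1 : ℕ) : ℝ) ^ 3 ≤ 2 / 2 ^ n := by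
    rw [abs_le] at h1 h2
    have : (2 : ℝ) / 2 ^ n = 1 / 2 ^ n + 1 / 2 ^ n := by ring
    linarith [h1.2, h2.1]
  rw [div_le_div_iff₀ (by positivity) (by positivity), one_mul] at h4
  have h5 : ((2 * (T + 1) ^ 3 : ℕ) : ℝ) < 2 ^ n := by simpa [← hT] using hn
  push_cast at h4 h5
  linarith
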